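/- \textbf{Proposition (basic properties of the weighted Chinese restaurant process).} Let $\theta>0$ and let $\mu$ be a probability distribution on $(0,\infty)$. Let $(W_i)_{i\ge 1}$ be i.i.d.\ random variables with distribution $\mu$ (the weights). Given $(W_i)_{i\geq1}$, the weighted Chinese restaurant process $(S_i(n)\colon i\ge 1)_{n\ge 0}$ is the Markov chain defined as follows, where $S_i(n)$ is the number of customers at table $i$ at time $n$ and $K_n=\max\{i\ge1\colon S_i(n)\ne 0\}$ is the number of occupied tables at time $n$. At time $0$, $S_1(0)=1$ and $S_i(0)=0$ for all $i\ge 2$. Given the configuration at time $n$, exactly one new customer arrives at time $n+1$; she sits at the occupied table $i\le K_n$, so that $S_i$ increases by one and all other sizes are unchanged, with probability proportional to $W_iS_i(n)$, and she opens the new table $K_n+1$, so that $S_{K_n+1}(n+1)=1$ and all other sizes are unchanged, with probability proportional to $\theta$. Suppose that $\mu$ has no atom at its essential supremum $\operatorname{ess\,sup}\mu\in(0,\infty]$. Then the following hold. (i) Almost surely, $$\lim_{n\to\infty}\frac{K_n}{\log n}=\frac{\theta}{\operatorname{ess\,sup}\mu},$$ where the right-hand side is interpreted as $0$ if $\operatorname{ess\,sup}\mu=\infty$.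 (ii) For every $k\ge1$, almost surely, $S_k(n)\to\infty$ and $S_k(n)/n\to 0$ as $n\to\infty$. (iii) Let $B_n$ be the time at which the most occupied table at time $n$ got its first customer. Then, almost surely, $B_n\to\infty$ as $n\to\infty$, however ties between most occupied tables are broken. (iv) Almost surely, the sequence $\left(\max_{i\ge1}S_i(n)/n\right)_{n\geq1}$ does not converge to $1$; that is, the event that it converges to $1$ has probability zero. -/

import Mathlib

open MeasureTheory ProbabilityTheory Filter Topology

namespace WeightedCRP

/-- The number of occupied tables of a configuration `s`, where `s i` is the number of customers
at table `i`. Tables are numbered `0, 1, 2, …` in the order of their creation, so in a reachable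
configuration the occupied tables are those with `i < numTables s`. -/
noncomputable def numTables (s : ℕ → ℕ) : ℕ := {i | s i ≠ 0}.ncard

/-- The configuration obtained from `s` when one more customer sits down at table `i`. -/
def seat (s : ℕ → ℕ) (i : ℕ) : ℕ → ℕ := Function.update s i (s i + 1)

/-- The propensity of the next customer to sit at table `i`: `w i * s i` for an occupied table, `θ`
for the next new table, and `0` for all others. -/
noncomputable def propensity (θ : ℝ) (w : ℕ → ℝ) (s : ℕ → ℕ) (i : ℕ) : ℝ :=
  if i < numTables s then w i * s i else if i = numTables s then θ else 0

/-- The probability that the next customer sits at table `i`: the propensity of table `i`, divided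
by the sum of the propensities of all occupied tables and of the new one. -/
noncomputable def seatProb (θ : ℝ) (w : ℕ → ℝ) (s : ℕ → ℕ) (i : ℕ) : ℝ :=
  propensity θ w s i / ∑ j ∈ Finset.range (numTables s + 1), propensity θ w s j

/-- The information consisting of all weights and of the configurations up to time `n`. -/
@[reducible] def history {Ω : Type*} (W : ℕ → Ω → ℝ) (S : ℕ → Ω → ℕ → ℕ) (n : ℕ) : MeasurableSpace Ω :=
  (⨆ i : ℕ, MeasurableSpace.comap (W i) inferInstance) ⊔
    ⨆ m : ℕ, ⨆ _ : m ≤ n, MeasurableSpace.comap (S m) inferInstance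

/-- `S n ω i` is the number of customers at table `i` at time `n`, and `W i ω` the weight of table
`i`, in a weighted Chinese restaurant process with parameter `θ` and weight distribution `μ`. -/
structure IsWeightedCRP {Ω : Type*} [MeasurableSpace Ω] (P : Measure Ω) (θ : ℝ) (μ : Measure ℝ)
    (W : ℕ → Ω → ℝ) (S : ℕ → Ω → ℕ → ℕ) : Prop where
  measurable_weight : ∀ i, Measurable (W i)
  indep_weight : iIndepFun W P
  law_weight : ∀ i, P.map (W i) = μ
  measurable_size : ∀ n, Measurable (S n)
  initial : ∀ᵐ ω ∂P, S 0 ω = Pi.single 0 1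
  step : ∀ n i,
    P[({ω | S (n + 1) ω = seat (S n ω) i}.indicator fun _ => (1 : ℝ)) | history W S n]
      =ᵐ[P] fun ω => seatProb θ (fun j => W j ω) (S n ω) i

/-- The essential supremum of a weight distribution on the real line, `⊤` if it is unbounded. -/
noncomputable def weightEssSup (μ : Measure ℝ) : EReal := essSup (fun x : ℝ => (x : EReal)) μ

/-- The first time at which table `i` is occupied, along the trajectory `s`. -/
noncomputable def creationTime (s : ℕ → ℕ → ℕ) (i : ℕ) : ℕ := sInf {m | s m i ≠ 0}

/-- Table `k` is a most occupied table of the configuration `s`. -/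
def IsLargestTable (s : ℕ → ℕ) (k : ℕ) : Prop := ∀ i, s i ≤ s k

end WeightedCRP

/-!
Let `T k` be the total propensity at time `k`, and measure time by the clock
`Φ n = ∑ k < n, 1 / T k`. On this time scale table `j` behaves like a branching process that grows
at rate `W j`, and new tables arrive at rate `θ`. This is made precise by one tool,
`IsWeightedCRP.ae_exists_le_exp_sum`: if the drift of a nonnegative function `G` of the weights and
the configuration is at most `(h / T) * G`, then `G` divided by `exp (∑ k < n, h k / T k)` is a
nonnegative supermartingale, hence almost surely bounded. It is applied to three functions.

* `exp (q * K)` with `q` close to `0` on either side, where `K` is the number of tables: then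
  `K n / Φ n → θ`. As a bounded number of tables would make `T` grow at most linearly and `Φ`
  diverge, both `Φ` and `K` tend to infinity.
* `X + θ / a`, where `X` is the number of customers at tables of weight at most `a`: then `X` is at
  most of order `exp (a * Φ)`.
* `1 / max (S j) 1`: then `S j → ∞`, and `S j` is at least of order `exp (b * Φ)` for each
  `b < W j`.

Almost surely, every level `a` below the essential supremum `M` of the weights is exceeded by the
weight of some table `j`, which outgrows all tables of weight at most `a` together
(`Typical.tendsto_lightCustomers_div_size`). As no weight attains `M`, every table is eventually
overtaken and its proportion vanishes; hence the leader changes forever and is created later and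
later. If the largest proportion tended to one, then eventually one and the same table would hold
more than three quarters of all customers, as two tables cannot do so at consecutive times, but its
proportion vanishes. Finally, almost all customers sit at tables of weight close to `M` (or above
any given level, if `M` is infinite), so that `T n / n → M`, `Φ n / log n → 1 / M` and
`K n / log n → θ / M`.
-/

namespace WeightedCRP

/-! ### Configurations -/

/-- The configurations which the process can reach at time `n`: the occupied tables form an initial
segment of the tables, and `n + 1` customers are seated. -/
structure Reachable (n : ℕ) (s : ℕ → ℕ) : Prop where
  occupied : ∀ i, s i ≠ 0 ↔ i < numTables s
  sum_eq : ∑ i ∈ Finset.range (numTables s), s i = n + 1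

/-- The sum of the propensities of all occupied tables and of the new one. -/
noncomputable def total (θ : ℝ) (w : ℕ → ℝ) (s : ℕ → ℕ) : ℝ :=
  ∑ j ∈ Finset.range (numTables s + 1), propensity θ w s j

lemma numTables_eq_of_forall {s : ℕ → ℕ} {K : ℕ} (h : ∀ i, s i ≠ 0 ↔ i < K) :
    numTables s = K := by
  have : {i | s i ≠ 0} = Set.Iio K := by ext i; simp [h i]
  rw [numTables, this, ← Finset.coe_Iio, Set.ncard_coe_finset, Nat.card_Iio]

lemma seat_self (s : ℕ → ℕ) (i : ℕ) : seat s i i = s i + 1 := by simp [seat]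

lemma seat_of_ne (s : ℕ → ℕ) {i j : ℕ} (h : j ≠ i) : seat s i j = s j := by simp [seat, h]

lemma le_seat (s : ℕ → ℕ) (i j : ℕ) : s j ≤ seat s i j := by
  by_cases h : j = i
  · subst h; simp [seat_self]
  · rw [seat_of_ne s h]

lemma seat_injective (s : ℕ → ℕ) : Function.Injective (seat s) := by
  intro i j h
  by_contra hne
  have := congrFun h i
  rw [seat_self, seat_of_ne s hne] at this
  omega

namespace Reachable

variable {n : ℕ} {s : ℕ → ℕ}

lemma eq_zero (h : Reachable n s) {i : ℕ} (hi : numTables s ≤ i) : s i = 0 := by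
  by_contra h'
  exact absurd ((h.occupied i).1 h') (by omega)

lemma pos (h : Reachable n s) {i : ℕ} (hi : i < numTables s) : 0 < s i :=
  Nat.pos_of_ne_zero ((h.occupied i).2 hi)

lemma numTables_pos (h : Reachable n s) : 0 < numTables s := by
  by_contra h0
  have h1 := h.sum_eq
  have : numTables s = 0 := by omega
  rw [this] at h1
  simp at h1

lemma numTables_le (h : Reachable n s) : numTables s ≤ n + 1 := by
  rw [← h.sum_eq]
  calc numTables s = ∑ i ∈ Finset.range (numTables s), 1 := by simp
    _ ≤ _ := Finset.sum_le_sum fun i hi => h.pos (Finset.mem_range.1 hi)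

lemma le_sum (h : Reachable n s) (t : Finset ℕ) : ∑ i ∈ t, s i ≤ n + 1 := by
  rw [← h.sum_eq]
  refine Finset.sum_le_sum_of_ne_zero fun i _ hi => ?_
  exact Finset.mem_range.2 ((h.occupied i).1 hi)

lemma le (h : Reachable n s) (i : ℕ) : s i ≤ n + 1 := by
  simpa using h.le_sum {i}

lemma numTables_seat_of_lt (h : Reachable n s) {i : ℕ} (hi : i < numTables s) :
    numTables (seat s i) = numTables s := by
  apply numTables_eq_of_forall
  intro j
  by_cases hj : j = i
  · subst hj; simp [seat_self, hi]
  · rw [seat_of_ne s hj]; exact h.occupied j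

lemma numTables_seat_new (h : Reachable n s) :
    numTables (WeightedCRP.seat s (numTables s)) = numTables s + 1 := by
  apply numTables_eq_of_forall
  intro j
  by_cases hj : j = numTables s
  · subst hj; simp [seat_self]
  · rw [seat_of_ne s hj, h.occupied j]; omega

lemma seat (h : Reachable n s) {i : ℕ} (hi : i ≤ numTables s) :
    Reachable (n + 1) (WeightedCRP.seat s i) := by
  rcases hi.lt_or_eq with hi | rfl
  · have hK := h.numTables_seat_of_lt hi
    refine ⟨fun j => ?_, ?_⟩
    · rw [hK]
      by_cases hj : j = i
      · subst hj; simp [seat_self, hi]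
      · rw [seat_of_ne s hj]; exact h.occupied j
    · rw [hK, ← h.sum_eq, WeightedCRP.seat,
        Finset.sum_update_of_mem (Finset.mem_range.2 hi),
        Finset.sdiff_singleton_eq_erase, ← Finset.add_sum_erase _ s (Finset.mem_range.2 hi)]
      ring
  · have hK := h.numTables_seat_new
    refine ⟨fun j => ?_, ?_⟩
    · rw [hK]
      by_cases hj : j = numTables s
      · subst hj; simp [seat_self]
      · rw [seat_of_ne s hj, h.occupied j]; omega
    · rw [hK, Finset.sum_range_succ, seat_self, ← h.sum_eq, h.eq_zero le_rfl]
      congr 1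
      exact Finset.sum_congr rfl fun j hj => seat_of_ne s (Finset.mem_range.1 hj).ne

end Reachable

lemma reachable_initial : Reachable 0 (Pi.single 0 1) := by
  have hK : numTables (Pi.single 0 1) = 1 := by
    apply numTables_eq_of_forall
    intro i
    rcases i with _ | i <;> simp
  refine ⟨fun i => ?_, ?_⟩
  · rw [hK]; rcases i with _ | i <;> simp
  · rw [hK]; simp

/-! ### Propensities -/

section Propensity

variable {θ : ℝ} {w : ℕ → ℝ} {s : ℕ → ℕ} {n : ℕ}

lemma sum_propensity_mul (θ : ℝ) (w : ℕ → ℝ) (s : ℕ → ℕ) (F : ℕ → ℝ) :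
    ∑ i ∈ Finset.range (numTables s + 1), propensity θ w s i * F i =
      ∑ i ∈ Finset.range (numTables s), w i * s i * F i + θ * F (numTables s) := by
  rw [Finset.sum_range_succ]
  congr 1
  · exact Finset.sum_congr rfl fun i hi => by rw [propensity, if_pos (Finset.mem_range.1 hi)]
  · simp [propensity]

lemma total_eq (θ : ℝ) (w : ℕ → ℝ) (s : ℕ → ℕ) :
    total θ w s = ∑ i ∈ Finset.range (numTables s), w i * s i + θ := by
  simpa [total] using sum_propensity_mul θ w s fun _ => 1

lemma propensity_nonneg (hθ : 0 < θ) (hw : ∀ i, 0 < w i) (i : ℕ) : 0 ≤ propensity θ w s i := by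
  unfold propensity
  split_ifs
  · exact mul_nonneg (hw i).le (Nat.cast_nonneg _)
  · exact hθ.le
  · exact le_rfl

lemma le_total (hw : ∀ i, 0 < w i) : θ ≤ total θ w s := by
  rw [total_eq]
  have : 0 ≤ ∑ i ∈ Finset.range (numTables s), w i * s i :=
    Finset.sum_nonneg fun i _ => mul_nonneg (hw i).le (Nat.cast_nonneg _)
  linarith

lemma total_pos (hθ : 0 < θ) (hw : ∀ i, 0 < w i) : 0 < total θ w s := hθ.trans_le (le_total hw)

lemma mul_le_total (hθ : 0 < θ) (hw : ∀ i, 0 < w i) (hs : Reachable n s) (j : ℕ) :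
    w j * s j ≤ total θ w s := by
  rw [total_eq]
  have hnn : ∀ i ∈ Finset.range (numTables s), 0 ≤ w i * s i :=
    fun i _ => mul_nonneg (hw i).le (Nat.cast_nonneg _)
  by_cases hj : j < numTables s
  · have := Finset.single_le_sum hnn (Finset.mem_range.2 hj)
    linarith
  · rw [hs.eq_zero (by omega)]
    have := Finset.sum_nonneg hnn
    simp only [Nat.cast_zero, mul_zero]
    linarith

lemma total_le_mul (hs : Reachable n s) {M : ℝ} (hM : ∀ i, w i ≤ M) :
    total θ w s ≤ M * (n + 1) + θ := by
  have hsum : ((n : ℝ) + 1) = ∑ i ∈ Finset.range (numTables s), (s i : ℝ) := by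
    exact_mod_cast hs.sum_eq.symm
  rw [total_eq, hsum, Finset.mul_sum]
  gcongr with i _
  exact hM i

/-- The number of customers at tables of weight at most `a`. -/
noncomputable def lightCustomers (a : ℝ) (w : ℕ → ℝ) (s : ℕ → ℕ) : ℝ :=
  ∑ i ∈ Finset.range (numTables s), if w i ≤ a then (s i : ℝ) else 0

lemma lightCustomers_nonneg (a : ℝ) (w : ℕ → ℝ) (s : ℕ → ℕ) : 0 ≤ lightCustomers a w s :=
  Finset.sum_nonneg fun i _ => by split_ifs <;> simp

lemma lightCustomers_le (hs : Reachable n s) (a : ℝ) : lightCustomers a w s ≤ n + 1 := by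
  have hsum : ((n : ℝ) + 1) = ∑ i ∈ Finset.range (numTables s), (s i : ℝ) := by
    exact_mod_cast hs.sum_eq.symm
  rw [hsum]
  exact Finset.sum_le_sum fun i _ => by split_ifs <;> simp

lemma le_lightCustomers (hs : Reachable n s) {a : ℝ} {k : ℕ} (hk : w k ≤ a) :
    (s k : ℝ) ≤ lightCustomers a w s := by
  by_cases h : k < numTables s
  · have := Finset.single_le_sum (f := fun i => if w i ≤ a then (s i : ℝ) else 0)
      (fun i _ => by split_ifs <;> simp) (Finset.mem_range.2 h)
    simpa [lightCustomers, hk] using this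
  · rw [hs.eq_zero (by omega)]
    simpa using lightCustomers_nonneg a w s

/-- All customers who do not sit at a table of weight at most `a` contribute more than `a` to the
total propensity. -/
lemma mul_sub_lightCustomers_le_total (hθ : 0 < θ) (hw : ∀ i, 0 < w i) (hs : Reachable n s)
    (a : ℝ) : a * (n + 1 - lightCustomers a w s) ≤ total θ w s := by
  have hsum : ((n : ℝ) + 1) = ∑ i ∈ Finset.range (numTables s), (s i : ℝ) := by
    exact_mod_cast hs.sum_eq.symm
  rw [hsum, lightCustomers, ← Finset.sum_sub_distrib, Finset.mul_sum, total_eq]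
  refine le_add_of_le_of_nonneg (Finset.sum_le_sum fun i _ => ?_) hθ.le
  split_ifs with h
  · simpa using mul_nonneg (hw i).le (Nat.cast_nonneg _)
  · rw [sub_zero]
    gcongr
    exact (not_le.1 h).le

/-! ### Drift inequalities -/

/-- The drift, on the scale of the total propensity, of the exponential of the number of tables. -/
lemma drift_exp_numTables (hs : Reachable n s) (l : ℝ) :
    ∑ i ∈ Finset.range (numTables s + 1),
        propensity θ w s i * Real.exp (l * numTables (seat s i)) =
      (total θ w s + θ * (Real.exp l - 1)) * Real.exp (l * numTables s) := by
  rw [sum_propensity_mul θ w s fun i => Real.exp (l * numTables (seat s i)),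
    hs.numTables_seat_new, total_eq, Finset.sum_congr rfl fun i hi => by
      rw [hs.numTables_seat_of_lt (Finset.mem_range.1 hi)], ← Finset.sum_mul]
  push_cast
  rw [mul_add, Real.exp_add, mul_one]
  ring

/-- The number of customers at tables of weight at most `a`, increased by `θ / a` so as to absorb
the arrival of new tables, grows at relative rate at most `a`. -/
lemma drift_lightCustomers (hθ : 0 < θ) {a : ℝ} (ha : 0 < a) (hs : Reachable n s) :
    ∑ i ∈ Finset.range (numTables s + 1),
        propensity θ w s i * (lightCustomers a w (seat s i) + θ / a) ≤
      (total θ w s + a) * (lightCustomers a w s + θ / a) := by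
  set K := numTables s with hK
  have hold : ∀ i < K, lightCustomers a w (seat s i) =
      lightCustomers a w s + if w i ≤ a then 1 else 0 := by
    intro i hi
    rw [lightCustomers, lightCustomers, hs.numTables_seat_of_lt hi, ← hK,
      ← Finset.add_sum_erase _ _ (Finset.mem_range.2 hi),
      ← Finset.add_sum_erase (Finset.range K) _ (Finset.mem_range.2 hi),
      seat_self, Finset.sum_congr rfl fun j hj => by rw [seat_of_ne s (Finset.ne_of_mem_erase hj)]]
    split_ifs <;> push_cast <;> ring
  have hnew : lightCustomers a w (seat s K) ≤ lightCustomers a w s + 1 := by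
    rw [lightCustomers, lightCustomers, hs.numTables_seat_new, Finset.sum_range_succ, ← hK,
      seat_self, hs.eq_zero le_rfl, Finset.sum_congr rfl fun j hj => by
        rw [seat_of_ne s (Finset.mem_range.1 hj).ne]]
    gcongr
    split_ifs <;> simp
  rw [sum_propensity_mul θ w s fun i => lightCustomers a w (seat s i) + θ / a, ← hK]
  have hsum : ∑ i ∈ Finset.range K, w i * s i * (lightCustomers a w (seat s i) + θ / a) ≤
      (∑ i ∈ Finset.range K, w i * s i) * (lightCustomers a w s + θ / a) +
        a * lightCustomers a w s := by
    have hlight : a * lightCustomers a w s =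
        ∑ i ∈ Finset.range K, a * if w i ≤ a then (s i : ℝ) else 0 := by
      rw [lightCustomers, Finset.mul_sum]
    rw [Finset.sum_mul, hlight, ← Finset.sum_add_distrib]
    refine Finset.sum_le_sum fun i hi => ?_
    rw [hold i (Finset.mem_range.1 hi)]
    split_ifs with h
    · have := mul_le_mul_of_nonneg_right h (Nat.cast_nonneg (α := ℝ) (s i))
      linarith
    · simp
  have h2 := mul_le_mul_of_nonneg_left hnew hθ.le
  have h3 : a * (θ / a) = θ := mul_div_cancel₀ _ ha.ne'
  rw [total_eq, ← hK]
  nlinarith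

/-- The reciprocal of the size of table `j` decreases at a relative rate that approaches `w j` as
the table grows. -/
lemma drift_inv_size (hθ : 0 < θ) (hw : ∀ i, 0 < w i) (hs : Reachable n s) (j : ℕ) :
    ∑ i ∈ Finset.range (numTables s + 1),
        propensity θ w s i * (max (seat s i j : ℝ) 1)⁻¹ ≤
      (total θ w s + -(w j * (s j / (s j + 1)))) * (max (s j : ℝ) 1)⁻¹ := by
  by_cases hj : j < numTables s
  · have h1 : (1 : ℝ) ≤ s j := by exact_mod_cast hs.pos hj
    rw [max_eq_left h1, ← Finset.add_sum_erase _ _ (Finset.mem_range.2 (Nat.lt_succ_of_lt hj)),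
      Finset.sum_congr rfl fun i hi => by
        rw [seat_of_ne s (Finset.ne_of_mem_erase hi).symm], ← Finset.sum_mul,
      Finset.sum_erase_eq_sub (Finset.mem_range.2 (Nat.lt_succ_of_lt hj)), seat_self,
      ← total, propensity, if_pos hj, max_eq_left h1]
    push_cast
    rw [max_eq_left (by linarith)]
    apply le_of_eq
    field_simp
    ring
  · have h0 := hs.eq_zero (not_lt.1 hj)
    rw [h0, total]
    simp only [Nat.cast_zero, zero_div, mul_zero, neg_zero, add_zero, zero_le_one, sup_of_le_right,
      inv_one, mul_one]
    refine Finset.sum_le_sum fun i _ => ?_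
    refine mul_le_of_le_one_right (propensity_nonneg hθ hw i) ?_
    exact inv_le_one_of_one_le₀ (le_max_right _ _)

end Propensity

/-! ### Measurability -/

lemma measurable_numTables : Measurable numTables := by
  have hpos : ∀ k, MeasurableSet (numTables ⁻¹' {k + 1}) := by
    intro k
    have : numTables ⁻¹' {k + 1} =
        ⋃ F ∈ {F : Finset ℕ | F.card = k + 1}, ⋂ i, {s | s i ≠ 0 ↔ i ∈ F} := by
      ext s
      simp only [Set.mem_preimage, Set.mem_singleton_iff, Set.mem_ofPred_eq, Set.mem_iUnion,
        Set.mem_iInter, exists_prop]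
      constructor
      · intro h
        have hfin : {i | s i ≠ 0}.Finite := Set.finite_of_ncard_ne_zero (by
          rw [numTables] at h; omega)
        refine ⟨hfin.toFinset, ?_, fun i => by simp⟩
        rw [← h, numTables, Set.ncard_eq_toFinset_card _ hfin]
      · rintro ⟨F, hF, h⟩
        have : {i | s i ≠ 0} = F := by ext i; simpa using h i
        rw [numTables, this, Set.ncard_coe_finset, hF]
    rw [this]
    refine MeasurableSet.biUnion (Set.to_countable _) fun F _ => MeasurableSet.iInter fun i => ?_
    exact measurableSet_preimage (measurable_pi_apply (X := fun _ : ℕ => ℕ) i)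
      (MeasurableSet.of_discrete (s := {x : ℕ | x ≠ 0 ↔ i ∈ F}))
  refine measurable_to_countable' fun k => ?_
  rcases k with _ | k
  · have : numTables ⁻¹' {0} = (⋃ k, numTables ⁻¹' {k + 1})ᶜ := by
      ext s
      simp only [Set.mem_preimage, Set.mem_singleton_iff, Set.mem_compl_iff, Set.mem_iUnion,
        not_exists]
      refine ⟨fun h k => by omega, fun h => ?_⟩
      by_contra h0
      exact h (numTables s - 1) (by omega)
    rw [this]
    exact (MeasurableSet.iUnion hpos).compl
  · exact hpos k

lemma measurable_seat (i : ℕ) : Measurable fun s => seat s i := by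
  refine measurable_pi_lambda _ fun j => ?_
  by_cases h : j = i
  · subst h
    simp only [seat_self]
    exact (measurable_pi_apply j).add_const 1
  · simp only [seat_of_ne _ h]
    exact measurable_pi_apply j

/-- The number of tables takes countably many values, so a function of the weights and the
configuration may be treated as if that number were fixed. -/
lemma measurable_comp_numTables {F : ℕ → (ℕ → ℝ) × (ℕ → ℕ) → ℝ} (hF : ∀ k, Measurable (F k)) :
    Measurable fun p : (ℕ → ℝ) × (ℕ → ℕ) => F (numTables p.2) p :=
  (measurable_from_prod_countable_right (f := fun q : ℕ × ((ℕ → ℝ) × (ℕ → ℕ)) => F q.1 q.2) hF).comp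
    ((measurable_numTables.comp measurable_snd).prodMk measurable_id)

lemma measurable_weight_apply (i : ℕ) : Measurable fun p : (ℕ → ℝ) × (ℕ → ℕ) => p.1 i :=
  (measurable_pi_apply i).comp measurable_fst

lemma measurable_size_apply (i : ℕ) : Measurable fun p : (ℕ → ℝ) × (ℕ → ℕ) => (p.2 i : ℝ) :=
  (measurable_from_top (f := fun n : ℕ => (n : ℝ))).comp
    ((measurable_pi_apply i).comp measurable_snd)

lemma measurable_total (θ : ℝ) :
    Measurable fun p : (ℕ → ℝ) × (ℕ → ℕ) => total θ p.1 p.2 := by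
  simp only [total_eq]
  refine measurable_comp_numTables
    (F := fun k p => ∑ i ∈ Finset.range k, p.1 i * (p.2 i : ℝ) + θ) fun k => ?_
  exact (Finset.measurable_sum _ fun i _ =>
    (measurable_weight_apply i).mul (measurable_size_apply i)).add_const θ

lemma measurable_lightCustomers (a : ℝ) :
    Measurable fun p : (ℕ → ℝ) × (ℕ → ℕ) => lightCustomers a p.1 p.2 :=
  measurable_comp_numTables
    (F := fun k p => ∑ i ∈ Finset.range k, if p.1 i ≤ a then (p.2 i : ℝ) else 0) fun _ =>
      Finset.measurable_sum _ fun i _ => Measurable.ite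
        (measurableSet_le (measurable_weight_apply i) measurable_const)
        (measurable_size_apply i) measurable_const

/-! ### One step of the process -/

section History

variable {Ω : Type*} {W : ℕ → Ω → ℝ} {S : ℕ → Ω → ℕ → ℕ}

lemma history_mono (W : ℕ → Ω → ℝ) (S : ℕ → Ω → ℕ → ℕ) : Monotone (history W S) :=
  fun _ _ hmn => sup_le le_sup_left
    (le_sup_of_le_right (iSup₂_le fun m h => le_iSup₂_of_le m (h.trans hmn) le_rfl))

lemma measurable_history_prodMk {m n : ℕ} (hmn : m ≤ n) :
    Measurable[history W S n] fun ω => ((fun j => W j ω), S m ω) := by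
  let _ : MeasurableSpace Ω := history W S n
  refine Measurable.prodMk ?_ ?_
  · refine measurable_pi_lambda _ fun j => ?_
    exact (comap_measurable (W j)).mono
      ((le_iSup (fun i => MeasurableSpace.comap (W i) inferInstance) j).trans le_sup_left) le_rfl
  · exact (comap_measurable (S m)).mono
      ((le_iSup₂_of_le (f := fun m (_ : m ≤ n) => MeasurableSpace.comap (S m) inferInstance)
        m hmn le_rfl).trans le_sup_right) le_rfl

lemma measurable_history_comp {g : (ℕ → ℝ) × (ℕ → ℕ) → ℝ} (hg : Measurable g) {m n : ℕ}
    (hmn : m ≤ n) : Measurable[history W S n] fun ω => g (fun j => W j ω, S m ω) :=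
  Measurable.comp hg (measurable_history_prodMk hmn)

/-- The event that the customer who arrives at time `n + 1` sits at table `i`. -/
def seatEvent (S : ℕ → Ω → ℕ → ℕ) (n i : ℕ) : Set Ω := {ω | S (n + 1) ω = seat (S n ω) i}

lemma sum_indicator_seatEvent {n : ℕ} {ω : Ω} (hK : numTables (S n ω) ≤ n + 1) {i : ℕ}
    (hi : i ≤ numTables (S n ω)) (h : S (n + 1) ω = seat (S n ω) i) (F : ℕ → ℝ) :
    ∑ j ∈ Finset.range (n + 2), (if j ≤ numTables (S n ω) then F j else 0) *
      (seatEvent S n j).indicator (fun _ => (1 : ℝ)) ω = F i := by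
  rw [Finset.sum_eq_single i]
  · rw [if_pos hi, Set.indicator_of_mem (show ω ∈ seatEvent S n i from h), mul_one]
  · intro j _ hj
    rw [Set.indicator_of_notMem, mul_zero]
    intro hj'
    exact hj (seat_injective _ (Eq.trans (Eq.symm hj') h))
  · intro h'
    simp only [Finset.mem_range] at h'
    omega

end History

section Dynamics

variable {Ω : Type*} [mΩ : MeasurableSpace Ω] {P : Measure Ω} [IsProbabilityMeasure P]
  {θ : ℝ} {μ : Measure ℝ} {W : ℕ → Ω → ℝ} {S : ℕ → Ω → ℕ → ℕ}

omit [IsProbabilityMeasure P] in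
lemma IsWeightedCRP.history_le (hS : IsWeightedCRP P θ μ W S) (n : ℕ) : history W S n ≤ mΩ :=
  sup_le (iSup_le fun i => (hS.measurable_weight i).comap_le)
    (iSup₂_le fun m _ => (hS.measurable_size m).comap_le)

/-- The filtration generated by all weights and by the configurations. -/
def IsWeightedCRP.filtration (hS : IsWeightedCRP P θ μ W S) : Filtration ℕ mΩ where
  seq := history W S
  mono' := history_mono W S
  le' := hS.history_le

omit [IsProbabilityMeasure P] in
lemma IsWeightedCRP.measurableSet_seatEvent (hS : IsWeightedCRP P θ μ W S) (n i : ℕ) :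
    MeasurableSet (seatEvent S n i) := by
  have : seatEvent S n i = ⋂ j, {ω | S (n + 1) ω j = seat (S n ω) i j} := by
    ext ω; simp [seatEvent, funext_iff]
  rw [this]
  refine MeasurableSet.iInter fun j => measurableSet_eq_fun ?_ ?_
  · exact (measurable_pi_apply j).comp (hS.measurable_size (n + 1))
  · exact (measurable_pi_apply j).comp ((measurable_seat i).comp (hS.measurable_size n))

/-- Only the tables up to the new one contribute to an average over the seat of the next
customer. -/
lemma Reachable.sum_mul_seatProb {n : ℕ} {s : ℕ → ℕ} (hs : Reachable n s) (θ : ℝ) (w F : ℕ → ℝ) :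
    ∑ i ∈ Finset.range (n + 2), (if i ≤ numTables s then F i else 0) * seatProb θ w s i =
      (∑ i ∈ Finset.range (numTables s + 1), propensity θ w s i * F i) / total θ w s := by
  rw [Finset.sum_div]
  have hsub : Finset.range (numTables s + 1) ⊆ Finset.range (n + 2) := by
    have := hs.numTables_le
    intro i
    simp only [Finset.mem_range]
    omega
  rw [← Finset.sum_subset hsub]
  · refine Finset.sum_congr rfl fun i hi => ?_
    rw [if_pos (Nat.lt_succ_iff.1 (Finset.mem_range.1 hi)), seatProb, total]
    ring
  · intro i _ hi
    rw [if_neg (by simpa using hi), zero_mul]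

/-- An average over the seat of the next customer, in terms of the seating probabilities. -/
lemma IsWeightedCRP.condExp_sum_indicator (hS : IsWeightedCRP P θ μ W S) {n : ℕ}
    (hr : ∀ᵐ ω ∂P, Reachable n (S n ω)) {F : ℕ → Ω → ℝ}
    (hF : ∀ i, StronglyMeasurable[history W S n] (F i)) (C : ℝ)
    (hC : ∀ᵐ ω ∂P, ∀ i ≤ numTables (S n ω), ‖F i ω‖ ≤ C) :
    P[∑ i ∈ Finset.range (n + 2), (fun ω => if i ≤ numTables (S n ω) then F i ω else 0) *
        (seatEvent S n i).indicator (fun _ => (1 : ℝ)) | history W S n] =ᵐ[P]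
      fun ω => (∑ i ∈ Finset.range (numTables (S n ω) + 1),
        propensity θ (fun j => W j ω) (S n ω) i * F i ω) / total θ (fun j => W j ω) (S n ω) := by
  set c : ℕ → Ω → ℝ := fun i ω => if i ≤ numTables (S n ω) then F i ω else 0 with hc
  set e : ℕ → Ω → ℝ := fun i => (seatEvent S n i).indicator fun _ => (1 : ℝ) with he
  have hcm : ∀ i, StronglyMeasurable[history W S n] (c i) := by
    intro i
    refine StronglyMeasurable.ite ?_ (hF i) stronglyMeasurable_const
    exact (measurable_numTables.comp (measurable_snd.comp (measurable_history_prodMk le_rfl)))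
      (MeasurableSet.of_discrete (s := {k | i ≤ k}))
  have hcb : ∀ᵐ ω ∂P, ∀ i, ‖c i ω‖ ≤ max C 0 := by
    filter_upwards [hC] with ω hω i
    simp only [hc]
    split_ifs with hi
    · exact (hω i hi).trans (le_max_left _ _)
    · simp
  have hei : ∀ i, Integrable (e i) P := fun i =>
    (integrable_const 1).indicator (hS.measurableSet_seatEvent n i)
  have hci : ∀ i, Integrable (c i * e i) P := fun i =>
    (hei i).bdd_mul ((hcm i).mono (hS.history_le n)).aestronglyMeasurable
      (hcb.mono fun ω h => h i)
  have hpull : ∀ i, P[c i * e i | history W S n] =ᵐ[P]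
      fun ω => c i ω * seatProb θ (fun j => W j ω) (S n ω) i := by
    intro i
    filter_upwards [condExp_mul_of_stronglyMeasurable_left (hcm i) (hci i) (hei i), hS.step n i]
      with ω h1 h2
    rw [h1, Pi.mul_apply]
    congr 1
  filter_upwards [condExp_finsetSum (fun i (_ : i ∈ Finset.range (n + 2)) => hci i) (history W S n),
    ae_all_iff.2 hpull, hr] with ω h1 h2 h3
  rw [h1, Finset.sum_apply, Finset.sum_congr rfl fun i _ => h2 i]
  exact h3.sum_mul_seatProb θ (fun j => W j ω) fun i => F i ω

/-- The next customer sits at an occupied table or at the new one. -/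
lemma IsWeightedCRP.ae_exists_seat (hS : IsWeightedCRP P θ μ W S) (hθ : 0 < θ)
    (hW : ∀ᵐ ω ∂P, ∀ i, 0 < W i ω) {n : ℕ} (hr : ∀ᵐ ω ∂P, Reachable n (S n ω)) :
    ∀ᵐ ω ∂P, ∃ i ≤ numTables (S n ω), S (n + 1) ω = seat (S n ω) i := by
  -- The indicator `f` of the claimed event has conditional expectation one, as the seating
  -- probabilities sum to one.
  set f : Ω → ℝ := ∑ i ∈ Finset.range (n + 2),
    (fun ω => if i ≤ numTables (S n ω) then (1 : ℝ) else 0) *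
      (seatEvent S n i).indicator (fun _ => (1 : ℝ)) with hf
  have hfapp : ∀ ω, f ω = ∑ i ∈ Finset.range (n + 2),
      (if i ≤ numTables (S n ω) then (1 : ℝ) else 0) *
        (seatEvent S n i).indicator (fun _ => (1 : ℝ)) ω := by
    intro ω; simp [hf]
  have hcond := hS.condExp_sum_indicator hr (F := fun _ _ => 1)
    (fun _ => stronglyMeasurable_const) 1 (by simp)
  have hcond1 : P[f | history W S n] =ᵐ[P] fun _ => 1 := by
    filter_upwards [hcond, hW] with ω h hw
    rw [h]
    simp only [mul_one]
    exact div_self (total_pos hθ hw).ne'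
  have hint : ∫ ω, f ω ∂P = 1 := by
    rw [← integral_condExp (hS.history_le n), integral_congr_ae hcond1]
    simp
  have hzero : ∀ ω, (¬ ∃ i ≤ numTables (S n ω), S (n + 1) ω = seat (S n ω) i) → f ω = 0 := by
    intro ω h
    rw [hfapp]
    refine Finset.sum_eq_zero fun i _ => ?_
    by_cases hi : i ≤ numTables (S n ω)
    · rw [Set.indicator_of_notMem (show ω ∉ seatEvent S n i from fun h' => h ⟨i, hi, h'⟩), mul_zero]
    · rw [if_neg hi, zero_mul]
  have hle : ∀ᵐ ω ∂P, 0 ≤ 1 - f ω := by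
    filter_upwards [hr] with ω hω
    by_cases h : ∃ i ≤ numTables (S n ω), S (n + 1) ω = seat (S n ω) i
    · obtain ⟨i, hi, hi'⟩ := h
      rw [hfapp, sum_indicator_seatEvent hω.numTables_le hi hi' fun _ => 1, sub_self]
    · rw [hzero ω h]; norm_num
  have hfi : Integrable f P := by
    by_contra h
    rw [integral_undef h] at hint
    norm_num at hint
  have hint0 : ∫ ω, (1 - f ω) ∂P = 0 := by
    rw [integral_sub (integrable_const 1) hfi, hint]
    simp
  filter_upwards [(integral_eq_zero_iff_of_nonneg_ae hle ((integrable_const 1).sub hfi)).1 hint0]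
    with ω hω
  by_contra h
  rw [Pi.zero_apply, hzero ω h] at hω
  norm_num at hω

lemma IsWeightedCRP.ae_reachable (hS : IsWeightedCRP P θ μ W S) (hθ : 0 < θ)
    (hW : ∀ᵐ ω ∂P, ∀ i, 0 < W i ω) (n : ℕ) : ∀ᵐ ω ∂P, Reachable n (S n ω) := by
  induction n with
  | zero =>
    filter_upwards [hS.initial] with ω hω
    rw [hω]
    exact reachable_initial
  | succ n ih =>
    filter_upwards [ih, hS.ae_exists_seat hθ hW ih] with ω h ⟨i, hi, h'⟩
    rw [h']
    exact h.seat hi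

/-- A bounded function of the history and of the seat of the next customer is averaged by means of
the propensities. -/
lemma IsWeightedCRP.condExp_eq (hS : IsWeightedCRP P θ μ W S) (hθ : 0 < θ)
    (hW : ∀ᵐ ω ∂P, ∀ i, 0 < W i ω) {n : ℕ} {F : ℕ → Ω → ℝ}
    (hF : ∀ i, StronglyMeasurable[history W S n] (F i)) (C : ℝ)
    (hC : ∀ᵐ ω ∂P, ∀ i ≤ numTables (S n ω), ‖F i ω‖ ≤ C) {Y : Ω → ℝ}
    (hY : ∀ ω i, S (n + 1) ω = seat (S n ω) i → Y ω = F i ω) :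
    P[Y | history W S n] =ᵐ[P]
      fun ω => (∑ i ∈ Finset.range (numTables (S n ω) + 1),
        propensity θ (fun j => W j ω) (S n ω) i * F i ω) / total θ (fun j => W j ω) (S n ω) := by
  have hr := hS.ae_reachable hθ hW n
  refine EventuallyEq.trans (condExp_congr_ae ?_) (hS.condExp_sum_indicator hr hF C hC)
  filter_upwards [hr, hS.ae_exists_seat hθ hW hr] with ω h ⟨i, hi, h'⟩
  rw [hY ω i h', Finset.sum_apply]
  exact (sum_indicator_seatEvent h.numTables_le hi h' fun i => F i ω).symm

/-! ### Exponential growth bounds -/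

/-- A nonnegative supermartingale is almost surely bounded. -/
lemma _root_.MeasureTheory.Supermartingale.ae_bddAbove_of_nonneg {ℱ : Filtration ℕ mΩ}
    {Z : ℕ → Ω → ℝ} (hZ : Supermartingale Z ℱ P) (h0 : ∀ n ω, 0 ≤ Z n ω) :
    ∀ᵐ ω ∂P, BddAbove (Set.range fun n => Z n ω) := by
  have hbdd : ∀ n, eLpNorm ((-Z) n) 1 P ≤ ((∫ ω, Z 0 ω ∂P).toNNReal : ENNReal) := by
    intro n
    rw [Pi.neg_apply, eLpNorm_neg, eLpNorm_one_eq_lintegral_enorm,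
      ← ofReal_integral_norm_eq_lintegral_enorm (hZ.integrable n)]
    refine ENNReal.ofReal_le_ofReal ?_
    have := hZ.setIntegral_le (Nat.zero_le n) MeasurableSet.univ
    simp only [setIntegral_univ] at this
    simpa only [Real.norm_of_nonneg (h0 n _)] using this
  filter_upwards [hZ.neg.exists_ae_tendsto_of_bdd hbdd] with ω ⟨c, hc⟩
  have := hc.neg
  simp only [Pi.neg_apply, neg_neg] at this
  exact this.bddAbove_range

/-- A nonnegative function `G` of the weights and the configuration whose drift is at most
`h / total` times `G` grows at most like the exponential of the accumulated rate `h / total`: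
divided by that exponential it is a supermartingale. -/
theorem IsWeightedCRP.ae_exists_le_exp_sum (hS : IsWeightedCRP P θ μ W S) (hθ : 0 < θ)
    (hW : ∀ᵐ ω ∂P, ∀ i, 0 < W i ω) {G h : (ℕ → ℝ) × (ℕ → ℕ) → ℝ}
    (hG : Measurable G) (hh : Measurable h) (hG0 : ∀ p, 0 ≤ G p) (C : ℕ → ℝ)
    (hGC : ∀ n w s, Reachable n s → G (w, s) ≤ C n)
    (hhT : ∀ n w s, (∀ i, 0 < w i) → Reachable n s → -total θ w s ≤ h (w, s))
    (hdrift : ∀ n w s, (∀ i, 0 < w i) → Reachable n s →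
      ∑ i ∈ Finset.range (numTables s + 1), propensity θ w s i * G (w, seat s i) ≤
        (total θ w s + h (w, s)) * G (w, s)) :
    ∀ᵐ ω ∂P, ∃ C, ∀ n, G (fun j => W j ω, S n ω) ≤
      C * Real.exp (∑ k ∈ Finset.range n,
        h (fun j => W j ω, S k ω) / total θ (fun j => W j ω) (S k ω)) := by
  set A : ℕ → Ω → ℝ := fun n ω => ∑ k ∈ Finset.range n,
    h (fun j => W j ω, S k ω) / total θ (fun j => W j ω) (S k ω) with hA
  set Z : ℕ → Ω → ℝ := fun n ω => Real.exp (-A n ω) * G (fun j => W j ω, S n ω) with hZ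
  have hAm : ∀ n m, n ≤ m + 1 → Measurable[history W S m] (A n) := by
    intro n m hnm
    refine Finset.measurable_sum _ fun k hk => ?_
    have hk' : k ≤ m := by have := Finset.mem_range.1 hk; omega
    exact (measurable_history_comp hh hk').fun_div
      (measurable_history_comp (measurable_total θ) hk')
  -- The bound `-total ≤ h` keeps `exp (-A n)` bounded, so that `Z n` is integrable.
  have hAb : ∀ᵐ ω ∂P, ∀ n, -A n ω ≤ n := by
    filter_upwards [hW, ae_all_iff.2 (hS.ae_reachable hθ hW)] with ω hw hr n
    rw [hA, ← Finset.sum_neg_distrib]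
    have hle : ∀ k ∈ Finset.range n,
        -(h (fun j => W j ω, S k ω) / total θ (fun j => W j ω) (S k ω)) ≤ 1 := by
      intro k _
      rw [← neg_div, div_le_one (total_pos hθ hw)]
      linarith [hhT k _ _ hw (hr k)]
    simpa using Finset.sum_le_sum hle
  have hexp : ∀ {n m : ℕ} {x : ℝ}, x ≤ n → ∀ {w : ℕ → ℝ} {s : ℕ → ℕ}, Reachable m s →
      ‖Real.exp x * G (w, s)‖ ≤ Real.exp n * C m := by
    intro n m x hx w s hs
    rw [Real.norm_of_nonneg (mul_nonneg (Real.exp_pos _).le (hG0 _))]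
    exact mul_le_mul (Real.exp_le_exp.2 hx) (hGC m w s hs) (hG0 _) (Real.exp_pos _).le
  have hZm : ∀ n, StronglyMeasurable[history W S n] (Z n) := fun n =>
    ((Real.measurable_exp.comp (hAm n n (Nat.le_succ n)).neg).mul
      (hG.comp (measurable_history_prodMk le_rfl))).stronglyMeasurable
  have hZi : ∀ n, Integrable (Z n) P := by
    intro n
    refine Integrable.of_bound ((hZm n).mono (hS.history_le n)).aestronglyMeasurable
      (Real.exp n * C n) ?_
    filter_upwards [hAb, hS.ae_reachable hθ hW n] with ω h1 h2
    exact hexp (h1 n) h2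
  have hstep : ∀ n, P[Z (n + 1) | history W S n] ≤ᵐ[P] Z n := by
    intro n
    set F : ℕ → Ω → ℝ := fun i ω =>
      Real.exp (-A (n + 1) ω) * G (fun j => W j ω, seat (S n ω) i) with hF
    have hFm : ∀ i, StronglyMeasurable[history W S n] (F i) := by
      intro i
      refine ((Real.measurable_exp.comp (hAm (n + 1) n le_rfl).neg).mul
        (hG.comp ?_)).stronglyMeasurable
      have := measurable_history_prodMk (W := W) (S := S) (le_refl n)
      exact (measurable_fst.comp this).prodMk ((measurable_seat i).comp (measurable_snd.comp this))
    have hFb : ∀ᵐ ω ∂P, ∀ i ≤ numTables (S n ω), ‖F i ω‖ ≤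
        Real.exp ((n + 1 : ℕ) : ℝ) * C (n + 1) := by
      filter_upwards [hAb, hS.ae_reachable hθ hW n] with ω h1 h2 i hi
      exact hexp (h1 (n + 1)) (h2.seat hi)
    filter_upwards [hS.condExp_eq hθ hW hFm _ hFb (Y := Z (n + 1))
      (fun ω i hi => by simp only [hZ, hF, hi]), hW, hS.ae_reachable hθ hW n] with ω h1 hw hr
    have hT := total_pos hθ hw (s := S n ω)
    have hsum : ∑ i ∈ Finset.range (numTables (S n ω) + 1),
        propensity θ (fun j => W j ω) (S n ω) i * F i ω = Real.exp (-A (n + 1) ω) *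
          ∑ i ∈ Finset.range (numTables (S n ω) + 1),
            propensity θ (fun j => W j ω) (S n ω) i * G (fun j => W j ω, seat (S n ω) i) := by
      rw [Finset.mul_sum]
      exact Finset.sum_congr rfl fun i _ => by simp only [hF]; ring
    rw [h1, hsum, div_le_iff₀ hT]
    set r := h (fun j => W j ω, S n ω) / total θ (fun j => W j ω) (S n ω) with hrdef
    have hAs : A (n + 1) ω = A n ω + r := Finset.sum_range_succ _ _
    -- The drift factor `total + h = total * (1 + r)` is at most `total * exp r`.
    have hr1 : total θ (fun j => W j ω) (S n ω) + h (fun j => W j ω, S n ω) ≤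
        total θ (fun j => W j ω) (S n ω) * Real.exp r := by
      have h2 : h (fun j => W j ω, S n ω) = total θ (fun j => W j ω) (S n ω) * r := by
        rw [hrdef]; field_simp
      rw [h2]
      nlinarith [Real.add_one_le_exp r]
    calc Real.exp (-A (n + 1) ω) * ∑ i ∈ Finset.range (numTables (S n ω) + 1),
            propensity θ (fun j => W j ω) (S n ω) i * G (fun j => W j ω, seat (S n ω) i)
        ≤ Real.exp (-A (n + 1) ω) * (total θ (fun j => W j ω) (S n ω) * Real.exp r *
            G (fun j => W j ω, S n ω)) := by
          gcongr
          exact (hdrift n _ _ hw hr).trans (mul_le_mul_of_nonneg_right hr1 (hG0 _))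
      _ = Z n ω * total θ (fun j => W j ω) (S n ω) := by
          simp only [hZ]
          rw [hAs, neg_add, Real.exp_add, Real.exp_neg r]
          field_simp
  have hsuper : Supermartingale Z hS.filtration P := supermartingale_nat hZm hZi hstep
  filter_upwards [hsuper.ae_bddAbove_of_nonneg fun n ω =>
    mul_nonneg (Real.exp_pos _).le (hG0 _)] with ω ⟨c, hc⟩
  refine ⟨c, fun n => ?_⟩
  have h1 : Z n ω ≤ c := hc ⟨n, rfl⟩
  calc G (fun j => W j ω, S n ω) = Z n ω * Real.exp (A n ω) := by
        simp only [hZ]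
        rw [mul_right_comm, ← Real.exp_add]
        simp
    _ ≤ c * Real.exp (A n ω) := by gcongr

end Dynamics

/-! ### Typical trajectories -/

/-- The accumulated reciprocal of the total propensity along the trajectory `s`. On this time scale
table `i` grows exponentially at rate `w i`, and new tables arrive at rate `θ`. -/
noncomputable def clock (θ : ℝ) (w : ℕ → ℝ) (s : ℕ → ℕ → ℕ) (n : ℕ) : ℝ :=
  ∑ k ∈ Finset.range n, (total θ w (s k))⁻¹

/-- The properties of the weights `w` and of the trajectory `s` which hold almost surely and from
which the limit behaviour follows, where `M` is the essential supremum of the weights. The growth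
bounds are restricted to rational parameters, so that they hold simultaneously. -/
structure Typical (θ : ℝ) (M : EReal) (w : ℕ → ℝ) (s : ℕ → ℕ → ℕ) : Prop where
  weight_pos : ∀ i, 0 < w i
  weight_lt : ∀ i, (w i : EReal) < M
  exists_weight_gt : ∀ q : ℚ, ((q : ℝ) : EReal) < M → ∃ i, (q : ℝ) < w i
  reachable : ∀ n, Reachable n (s n)
  mono : ∀ i, Monotone fun n => s n i
  exp_numTables_le : ∀ q : ℚ, ∃ C, ∀ n,
    Real.exp (q * numTables (s n)) ≤ C * Real.exp (θ * (Real.exp q - 1) * clock θ w s n)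
  lightCustomers_le : ∀ q : ℚ, 0 < q → ∃ C, ∀ n,
    lightCustomers q w (s n) ≤ C * Real.exp (q * clock θ w s n)
  inv_size_le : ∀ j, ∃ C, ∀ n, (max (s n j : ℝ) 1)⁻¹ ≤ C * Real.exp (-(w j *
    ∑ k ∈ Finset.range n, (s k j / (s k j + 1) : ℝ) * (total θ w (s k))⁻¹))

section Dynamics

variable {Ω : Type*} [mΩ : MeasurableSpace Ω] {P : Measure Ω} [IsProbabilityMeasure P]
  {θ : ℝ} {μ : Measure ℝ} {W : ℕ → Ω → ℝ} {S : ℕ → Ω → ℕ → ℕ}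

omit [IsProbabilityMeasure P] in
lemma IsWeightedCRP.ae_forall_weight (hS : IsWeightedCRP P θ μ W S) {p : ℝ → Prop}
    (hp : ∀ᵐ x ∂μ, p x) : ∀ᵐ ω ∂P, ∀ i, p (W i ω) := by
  refine ae_all_iff.2 fun i => ?_
  rw [← hS.law_weight i] at hp
  exact ae_of_ae_map (hS.measurable_weight i).aemeasurable hp

omit [IsProbabilityMeasure P] in
/-- Independent weights exceed every level that a single weight exceeds with positive
probability. -/
lemma IsWeightedCRP.ae_exists_weight_gt (hS : IsWeightedCRP P θ μ W S) {a : ℝ}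
    (ha : μ (Set.Iic a) < 1) : ∀ᵐ ω ∂P, ∃ i, a < W i ω := by
  have hle : ∀ n : ℕ, P {ω | ¬ ∃ i, a < W i ω} ≤ μ (Set.Iic a) ^ n := by
    intro n
    calc P {ω | ¬ ∃ i, a < W i ω} ≤ P (⋂ i ∈ Finset.range n, W i ⁻¹' Set.Iic a) := by
          refine measure_mono fun ω hω => ?_
          simp only [Set.mem_iInter, Set.mem_preimage, Set.mem_Iic]
          intro i _
          by_contra h
          exact hω ⟨i, not_le.1 h⟩
      _ = ∏ i ∈ Finset.range n, P (W i ⁻¹' Set.Iic a) :=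
          hS.indep_weight.measure_inter_preimage_eq_mul (Finset.range n)
            (sets := fun _ => Set.Iic a) fun _ _ => measurableSet_Iic
      _ = μ (Set.Iic a) ^ n := by
          rw [Finset.prod_congr rfl fun i _ => by
            rw [← Measure.map_apply (hS.measurable_weight i) measurableSet_Iic, hS.law_weight i]]
          simp
  exact le_antisymm (ge_of_tendsto' (ENNReal.tendsto_pow_atTop_nhds_zero_of_lt_one ha) hle)
    zero_le

lemma measure_Iic_lt_one_of_lt_weightEssSup [IsProbabilityMeasure μ] {a : ℝ}
    (ha : (a : EReal) < weightEssSup μ) : μ (Set.Iic a) < 1 := by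
  refine lt_of_le_of_ne prob_le_one fun h => ?_
  have hae : ∀ᵐ x ∂μ, x ∈ Set.Iic a := by
    rw [← prob_compl_eq_zero_iff measurableSet_Iic] at h
    exact h
  refine absurd (essSup_le_of_ae_le (a : EReal) ?_) (not_le.2 ha)
  filter_upwards [hae] with x hx
  exact EReal.coe_le_coe_iff.2 hx

lemma ae_lt_weightEssSup (hμ : μ {x : ℝ | (x : EReal) = weightEssSup μ} = 0) :
    ∀ᵐ x : ℝ ∂μ, (x : EReal) < weightEssSup μ := by
  have h1 : ∀ᵐ x : ℝ ∂μ, (x : EReal) ≤ weightEssSup μ :=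
    ae_le_essSup (f := fun x : ℝ => (x : EReal))
  have h2 : ∀ᵐ x : ℝ ∂μ, ¬ (x : EReal) = weightEssSup μ := by
    rw [ae_iff]; simpa using hμ
  filter_upwards [h1, h2] with x h h' using lt_of_le_of_ne h h'

lemma IsWeightedCRP.ae_exp_numTables_le (hS : IsWeightedCRP P θ μ W S) (hθ : 0 < θ)
    (hW : ∀ᵐ ω ∂P, ∀ i, 0 < W i ω) (l : ℝ) :
    ∀ᵐ ω ∂P, ∃ C, ∀ n, Real.exp (l * numTables (S n ω)) ≤ C * Real.exp
      (θ * (Real.exp l - 1) * clock θ (fun j => W j ω) (fun m => S m ω) n) := by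
  have hmeas : Measurable fun p : (ℕ → ℝ) × (ℕ → ℕ) => Real.exp (l * numTables p.2) :=
    measurable_comp_numTables (F := fun k _ => Real.exp (l * k)) fun _ => measurable_const
  refine (hS.ae_exists_le_exp_sum hθ hW (h := fun _ => θ * (Real.exp l - 1)) hmeas
    measurable_const (fun _ => (Real.exp_pos _).le) (fun n => Real.exp (|l| * (n + 1 : ℕ)))
    (fun n w s hs => ?_) (fun n w s hw hs => ?_)
    (fun n w s _ hs => (drift_exp_numTables hs l).le)).mono ?_
  · refine Real.exp_le_exp.2 (mul_le_mul (le_abs_self l) ?_ (Nat.cast_nonneg _) (abs_nonneg l))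
    exact_mod_cast hs.numTables_le
  · have h1 := le_total (θ := θ) (s := s) hw
    have h2 := mul_pos hθ (Real.exp_pos l)
    linarith
  · rintro ω ⟨C, hC⟩
    refine ⟨C, fun n => (hC n).trans_eq ?_⟩
    rw [clock, Finset.mul_sum]
    simp only [div_eq_mul_inv]

lemma IsWeightedCRP.ae_lightCustomers_le (hS : IsWeightedCRP P θ μ W S) (hθ : 0 < θ)
    (hW : ∀ᵐ ω ∂P, ∀ i, 0 < W i ω) {a : ℝ} (ha : 0 < a) :
    ∀ᵐ ω ∂P, ∃ C, ∀ n, lightCustomers a (fun j => W j ω) (S n ω) ≤ C * Real.exp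
      (a * clock θ (fun j => W j ω) (fun m => S m ω) n) := by
  have hc : 0 < θ / a := div_pos hθ ha
  refine (hS.ae_exists_le_exp_sum hθ hW (h := fun _ => a)
    ((measurable_lightCustomers a).add_const (θ / a))
    measurable_const (fun p => add_nonneg (lightCustomers_nonneg a p.1 p.2) hc.le)
    (fun n => (n + 1) + θ / a) (fun n w s hs => ?_) (fun n w s hw hs => ?_)
    (fun n w s _ hs => drift_lightCustomers hθ ha hs)).mono ?_
  · have := lightCustomers_le (w := w) hs a
    dsimp only
    linarith
  · have := total_pos hθ hw (s := s)
    linarith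
  · rintro ω ⟨C, hC⟩
    refine ⟨C, fun n => le_trans (le_add_of_nonneg_right hc.le) ((hC n).trans_eq ?_)⟩
    rw [clock, Finset.mul_sum]
    simp only [div_eq_mul_inv]

lemma IsWeightedCRP.ae_inv_size_le (hS : IsWeightedCRP P θ μ W S) (hθ : 0 < θ)
    (hW : ∀ᵐ ω ∂P, ∀ i, 0 < W i ω) (j : ℕ) :
    ∀ᵐ ω ∂P, ∃ C, ∀ n, (max (S n ω j : ℝ) 1)⁻¹ ≤ C * Real.exp (-(W j ω *
      ∑ k ∈ Finset.range n, (S k ω j / (S k ω j + 1) : ℝ) *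
        (total θ (fun j => W j ω) (S k ω))⁻¹)) := by
  refine (hS.ae_exists_le_exp_sum hθ hW
    (G := fun p => (max (p.2 j : ℝ) 1)⁻¹) (h := fun p => -(p.1 j * (p.2 j / (p.2 j + 1))))
    ((measurable_size_apply j).max measurable_const).inv
    ((measurable_weight_apply j).mul ((measurable_size_apply j).div
      ((measurable_size_apply j).add_const 1))).neg
    (fun p => inv_nonneg.2 (zero_le_one.trans (le_max_right _ _))) (fun _ => 1)
    (fun n w s hs => inv_le_one_of_one_le₀ (le_max_right _ _)) (fun n w s hw hs => ?_)
    (fun n w s hw hs => drift_inv_size hθ hw hs j)).mono ?_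
  · have h1 := mul_le_total hθ hw hs j
    have h2 : w j * ((s j : ℝ) / (s j + 1)) ≤ w j * s j := by
      refine mul_le_mul_of_nonneg_left (div_le_self (Nat.cast_nonneg _) ?_) (hw j).le
      linarith [Nat.cast_nonneg (α := ℝ) (s j)]
    dsimp only
    linarith
  · rintro ω ⟨C, hC⟩
    refine ⟨C, fun n => (hC n).trans_eq ?_⟩
    rw [Finset.mul_sum, ← Finset.sum_neg_distrib]
    congr 2
    exact Finset.sum_congr rfl fun k _ => by rw [div_eq_mul_inv]; ring

theorem IsWeightedCRP.ae_typical [IsProbabilityMeasure μ] (hS : IsWeightedCRP P θ μ W S)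
    (hθ : 0 < θ) (hpos : μ (Set.Iic 0) = 0)
    (hatom : μ {x : ℝ | (x : EReal) = weightEssSup μ} = 0) :
    ∀ᵐ ω ∂P, Typical θ (weightEssSup μ) (fun j => W j ω) (fun n => S n ω) := by
  have hW : ∀ᵐ ω ∂P, ∀ i, 0 < W i ω := by
    refine hS.ae_forall_weight ?_
    rw [ae_iff]
    simpa [Set.Iic] using hpos
  have hr : ∀ᵐ ω ∂P, ∀ n, Reachable n (S n ω) := ae_all_iff.2 (hS.ae_reachable hθ hW)
  have hseat : ∀ᵐ ω ∂P, ∀ n, ∃ i ≤ numTables (S n ω), S (n + 1) ω = seat (S n ω) i :=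
    ae_all_iff.2 fun n => hS.ae_exists_seat hθ hW (hS.ae_reachable hθ hW n)
  have hgt : ∀ᵐ ω ∂P, ∀ q : ℚ, ((q : ℝ) : EReal) < weightEssSup μ → ∃ i, (q : ℝ) < W i ω := by
    refine ae_all_iff.2 fun q => ?_
    by_cases hq : ((q : ℝ) : EReal) < weightEssSup μ
    · filter_upwards [hS.ae_exists_weight_gt (measure_Iic_lt_one_of_lt_weightEssSup hq)]
        with ω hω _ using hω
    · exact Eventually.of_forall fun ω h => absurd h hq
  have hlight : ∀ᵐ ω ∂P, ∀ q : ℚ, 0 < q → ∃ C, ∀ n,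
      lightCustomers q (fun j => W j ω) (S n ω) ≤ C * Real.exp
        (q * clock θ (fun j => W j ω) (fun m => S m ω) n) := by
    refine ae_all_iff.2 fun q => ?_
    by_cases hq : 0 < q
    · filter_upwards [hS.ae_lightCustomers_le hθ hW (a := q) (by exact_mod_cast hq)]
        with ω hω _ using hω
    · exact Eventually.of_forall fun ω h => absurd h hq
  filter_upwards [hW, hS.ae_forall_weight (ae_lt_weightEssSup hatom), hgt, hr, hseat,
    ae_all_iff.2 fun q : ℚ => hS.ae_exp_numTables_le hθ hW q, hlight,
    ae_all_iff.2 fun j => hS.ae_inv_size_le hθ hW j] with ω h1 h2 h3 h4 h5 h6 h7 h8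
  refine ⟨h1, h2, h3, h4, fun i => monotone_nat_of_le_succ fun n => ?_, h6, h7, h8⟩
  obtain ⟨k, _, hk⟩ := h5 n
  rw [hk]
  exact le_seat _ _ _

end Dynamics

/-! ### Limit behaviour of typical trajectories -/

lemma tendsto_sum_inv_add_one_div_log :
    Tendsto (fun n : ℕ => (∑ k ∈ Finset.range n, ((k : ℝ) + 1)⁻¹) / Real.log n) atTop (𝓝 1) := by
  have hlog : Tendsto (fun n : ℕ => Real.log n) atTop atTop :=
    Real.tendsto_log_atTop.comp tendsto_natCast_atTop_atTop
  have h1 := (Real.tendsto_harmonic_sub_log.div_atTop hlog).add_const 1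
  rw [zero_add] at h1
  refine h1.congr' ?_
  filter_upwards [hlog.eventually_gt_atTop 0] with n hn
  rw [sub_div, div_self hn.ne', sub_add_cancel]
  simp [harmonic]

lemma le_log_add_of_exp_le {x y C : ℝ} (h : Real.exp x ≤ C * Real.exp y) :
    x ≤ Real.log C + y := by
  have hC : 0 < C := pos_of_mul_pos_left ((Real.exp_pos x).trans_le h) (Real.exp_pos y).le
  rw [← Real.exp_log hC, ← Real.exp_add] at h
  simpa using h

namespace Typical

variable {θ : ℝ} {M : EReal} {w : ℕ → ℝ} {s : ℕ → ℕ → ℕ}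

lemma clock_mono (hs : Typical θ M w s) (hθ : 0 < θ) : Monotone (clock θ w s) := by
  refine monotone_nat_of_le_succ fun n => ?_
  rw [clock, clock, Finset.sum_range_succ]
  exact le_add_of_nonneg_right (inv_nonneg.2 (total_pos hθ hs.weight_pos).le)

lemma clock_nonneg (hs : Typical θ M w s) (hθ : 0 < θ) (n : ℕ) : 0 ≤ clock θ w s n :=
  Finset.sum_nonneg fun _ _ => inv_nonneg.2 (total_pos hθ hs.weight_pos).le

/-- The upper bound comes from the exponential of `q * K`, as `exp q - 1 ≤ q + q ^ 2`. -/
lemma exists_numTables_le (hs : Typical θ M w s) (hθ : 0 < θ) {q : ℚ} (hq : 0 < q) (hq1 : q ≤ 1) :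
    ∃ C, ∀ n, (numTables (s n) : ℝ) ≤ C + θ * (1 + q) * clock θ w s n := by
  obtain ⟨C, hC⟩ := hs.exp_numTables_le q
  have hq' : (0 : ℝ) < q := by exact_mod_cast hq
  have hq1' : (q : ℝ) ≤ 1 := by exact_mod_cast hq1
  refine ⟨Real.log C / q, fun n => ?_⟩
  have h1 := le_log_add_of_exp_le (hC n)
  have h2 := (abs_le.1 (Real.abs_exp_sub_one_sub_id_le
    (abs_le.2 ⟨by linarith, hq1'⟩ : |(q : ℝ)| ≤ 1))).2
  have h3 := mul_le_mul_of_nonneg_left h2 (mul_nonneg hθ.le (hs.clock_nonneg hθ n))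
  rw [← mul_le_mul_iff_right₀ hq', mul_add, mul_div_cancel₀ _ hq'.ne']
  nlinarith

/-- The lower bound comes from the exponential of `-q * K`, as `exp (-q) - 1 ≤ -q + q ^ 2`. -/
lemma exists_le_numTables (hs : Typical θ M w s) (hθ : 0 < θ) {q : ℚ} (hq : 0 < q) (hq1 : q ≤ 1) :
    ∃ C, ∀ n, θ * (1 - q) * clock θ w s n ≤ C + numTables (s n) := by
  obtain ⟨C, hC⟩ := hs.exp_numTables_le (-q)
  have hq' : (0 : ℝ) < q := by exact_mod_cast hq
  have hq1' : (q : ℝ) ≤ 1 := by exact_mod_cast hq1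
  refine ⟨Real.log C / q, fun n => ?_⟩
  have h1 := le_log_add_of_exp_le (hC n)
  push_cast at h1
  have h2 := (abs_le.1 (Real.abs_exp_sub_one_sub_id_le
    (abs_le.2 ⟨by linarith, by linarith⟩ : |-(q : ℝ)| ≤ 1))).2
  have h3 := mul_le_mul_of_nonneg_left h2 (mul_nonneg hθ.le (hs.clock_nonneg hθ n))
  rw [← mul_le_mul_iff_right₀ hq', mul_add, mul_div_cancel₀ _ hq'.ne']
  nlinarith

/-- If the clock were bounded, only finitely many tables would be opened, so that the total
propensity would grow at most linearly and the clock would diverge. -/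
lemma tendsto_clock (hs : Typical θ M w s) (hθ : 0 < θ) : Tendsto (clock θ w s) atTop atTop := by
  refine tendsto_atTop_atTop_of_monotone' (hs.clock_mono hθ) ?_
  rintro ⟨B, hB⟩
  have hB' : ∀ n, clock θ w s n ≤ B := fun n => hB ⟨n, rfl⟩
  obtain ⟨C, hC⟩ := hs.exists_numTables_le hθ (q := 1) one_pos le_rfl
  obtain ⟨N, hN⟩ := exists_nat_ge (C + θ * (1 + (1 : ℚ)) * B)
  have hK : ∀ n, numTables (s n) ≤ N := by
    intro n
    have h1 := mul_le_mul_of_nonneg_left (hB' n)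
      (mul_nonneg hθ.le (by norm_num : (0 : ℝ) ≤ 1 + (1 : ℚ)))
    exact_mod_cast (hC n).trans ((add_le_add_right h1 C).trans hN)
  set D : ℝ := ∑ i ∈ Finset.range N, w i + θ with hD
  have hwN : 0 ≤ ∑ i ∈ Finset.range N, w i := Finset.sum_nonneg fun i _ => (hs.weight_pos i).le
  have hD0 : 0 < D := by linarith
  have hT : ∀ n, total θ w (s n) ≤ D * (n + 1) := by
    intro n
    have h1 : ∑ i ∈ Finset.range (numTables (s n)), w i * s n i ≤
        ∑ i ∈ Finset.range N, w i * (n + 1) := by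
      refine (Finset.sum_le_sum fun i _ => ?_).trans
        (Finset.sum_le_sum_of_subset_of_nonneg (f := fun i => w i * ((n : ℝ) + 1))
          (Finset.range_mono (hK n)) fun i _ _ => ?_)
      · refine mul_le_mul_of_nonneg_left ?_ (hs.weight_pos i).le
        exact_mod_cast (hs.reachable n).le i
      · exact mul_nonneg (hs.weight_pos i).le (by positivity)
    rw [← Finset.sum_mul] at h1
    rw [total_eq, hD, add_mul]
    have : θ ≤ θ * (n + 1) := le_mul_of_one_le_right hθ.le (by simp)
    linarith
  have hdiv := (Real.tendsto_sum_range_one_div_nat_succ_atTop.const_mul_atTop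
    (inv_pos.2 hD0)).eventually_gt_atTop B
  obtain ⟨n, hn⟩ := hdiv.exists
  refine absurd (hB' n) (not_le.2 (hn.trans_le ?_))
  rw [clock, Finset.mul_sum]
  refine Finset.sum_le_sum fun k _ => ?_
  rw [one_div, ← mul_inv]
  exact inv_anti₀ (total_pos hθ hs.weight_pos) (hT k)

lemma tendsto_numTables_div_clock (hs : Typical θ M w s) (hθ : 0 < θ) :
    Tendsto (fun n => (numTables (s n) : ℝ) / clock θ w s n) atTop (𝓝 θ) := by
  have hcl := hs.tendsto_clock hθ
  rw [Metric.tendsto_atTop']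
  intro ε hε
  obtain ⟨q, hq0, hq⟩ := exists_rat_btwn (show (0 : ℝ) < min 1 (ε / (2 * θ)) by positivity)
  have hq0' : 0 < q := by exact_mod_cast hq0
  have hq1 : q ≤ 1 := by exact_mod_cast (hq.trans_le (min_le_left _ _)).le
  have hqε : (q : ℝ) * θ < ε / 2 := by
    have := hq.trans_le (min_le_right _ _)
    rw [lt_div_iff₀ (by positivity)] at this
    linarith
  obtain ⟨C₁, hC₁⟩ := hs.exists_numTables_le hθ hq0' hq1
  obtain ⟨C₂, hC₂⟩ := hs.exists_le_numTables hθ hq0' hq1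
  have hev : ∀ᶠ n in atTop, dist ((numTables (s n) : ℝ) / clock θ w s n) θ < ε := by
    filter_upwards [hcl.eventually_gt_atTop 0, hcl.eventually_gt_atTop (C₁ / (ε / 2)),
      hcl.eventually_gt_atTop (C₂ / (ε / 2))] with n h0 h1 h2
    rw [div_lt_iff₀ (by positivity)] at h1 h2
    have hqc := mul_lt_mul_of_pos_right hqε h0
    rw [Real.dist_eq, div_sub' h0.ne', abs_div, abs_of_pos h0, div_lt_iff₀ h0, abs_lt]
    constructor
    · nlinarith [hC₂ n]
    · nlinarith [hC₁ n]
  obtain ⟨N, hN⟩ := eventually_atTop.1 hev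
  exact ⟨N, fun n hn => hN n hn.le⟩

lemma tendsto_numTables (hs : Typical θ M w s) (hθ : 0 < θ) :
    Tendsto (fun n => numTables (s n)) atTop atTop := by
  rw [← tendsto_natCast_atTop_iff (R := ℝ)]
  have h := (hs.tendsto_clock hθ).atTop_mul_pos hθ (hs.tendsto_numTables_div_clock hθ)
  refine h.congr' ?_
  filter_upwards [(hs.tendsto_clock hθ).eventually_gt_atTop 0] with n hn
  exact mul_div_cancel₀ _ hn.ne'

/-- If the factor `s k j / (s k j + 1)` is eventually at least `δ`, then table `j` grows at least at
rate `δ * w j` on the time scale of the clock. -/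
lemma exists_exp_le_size (hs : Typical θ M w s) (hθ : 0 < θ) {j : ℕ} {δ : ℝ}
    (hδ : ∀ᶠ n in atTop, δ ≤ (s n j : ℝ) / (s n j + 1)) :
    ∃ C, ∀ᶠ n in atTop, δ * w j * clock θ w s n - C ≤ Real.log (max (s n j : ℝ) 1) := by
  obtain ⟨C, hC⟩ := hs.inv_size_le j
  obtain ⟨N, hN⟩ := eventually_atTop.1 hδ
  have hsum : ∀ n ≥ N, δ * clock θ w s n - δ * clock θ w s N ≤
      ∑ k ∈ Finset.range n, (s k j / (s k j + 1) : ℝ) * (total θ w (s k))⁻¹ := by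
    intro n hn
    induction n, hn using Nat.le_induction with
    | base =>
      rw [sub_self]
      exact Finset.sum_nonneg fun k _ =>
        mul_nonneg (by positivity) (inv_nonneg.2 (total_pos hθ hs.weight_pos).le)
    | succ n hn ih =>
      have h1 := mul_le_mul_of_nonneg_right (hN n hn)
        (inv_nonneg.2 (total_pos hθ hs.weight_pos (s := s n)).le)
      rw [Finset.sum_range_succ, clock, Finset.sum_range_succ, ← clock, mul_add]
      linarith
  refine ⟨Real.log C + w j * (δ * clock θ w s N), eventually_atTop.2 ⟨N, fun n hn => ?_⟩⟩
  have hpos : (0 : ℝ) < max (s n j : ℝ) 1 := zero_lt_one.trans_le (le_max_right _ _)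
  have h1 := hC n
  rw [← Real.exp_log hpos, ← Real.exp_neg] at h1
  have h2 := le_log_add_of_exp_le h1
  have h3 := mul_le_mul_of_nonneg_left (hsum n hn) (hs.weight_pos j).le
  nlinarith

lemma eventually_one_le (hs : Typical θ M w s) (hθ : 0 < θ) (j : ℕ) :
    ∀ᶠ n in atTop, 1 ≤ s n j := by
  filter_upwards [(hs.tendsto_numTables hθ).eventually_gt_atTop j] with n hn
  exact (hs.reachable n).pos hn

lemma tendsto_size (hs : Typical θ M w s) (hθ : 0 < θ) (j : ℕ) :
    Tendsto (fun n => s n j) atTop atTop := by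
  refine tendsto_atTop_atTop_of_monotone' (hs.mono j) ?_
  rintro ⟨B, hB⟩
  -- An occupied table grows at least at half of its limiting rate.
  obtain ⟨C, hC⟩ := hs.exists_exp_le_size hθ (j := j) (δ := 1 / 2) (by
    filter_upwards [hs.eventually_one_le hθ j] with n hn
    have hn' : (1 : ℝ) ≤ s n j := by exact_mod_cast hn
    rw [div_le_div_iff₀ (by norm_num) (by linarith)]
    linarith)
  have hcl := (hs.tendsto_clock hθ).const_mul_atTop
    (mul_pos (by norm_num : (0 : ℝ) < 1 / 2) (hs.weight_pos j))
  obtain ⟨n, h1, h2⟩ := (hC.and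
    (hcl.eventually_gt_atTop (Real.log (max (B : ℝ) 1) + C))).exists
  have h3 : Real.log (max (s n j : ℝ) 1) ≤ Real.log (max (B : ℝ) 1) := by
    refine Real.log_le_log (zero_lt_one.trans_le (le_max_right _ _)) (max_le_max_right 1 ?_)
    exact_mod_cast hB ⟨n, rfl⟩
  linarith

/-- A table of weight above `q` outgrows all tables of weight at most `q` together. -/
lemma tendsto_lightCustomers_div_size (hs : Typical θ M w s) (hθ : 0 < θ) {q : ℚ} (hq : 0 < q)
    {j : ℕ} (hj : (q : ℝ) < w j) :
    Tendsto (fun n => lightCustomers q w (s n) / s n j) atTop (𝓝 0) := by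
  have hwj := hs.weight_pos j
  have hq' : (0 : ℝ) < q := by exact_mod_cast hq
  -- The growth rate `b` of table `j` may be chosen between `q` and `w j`.
  obtain ⟨b, hqb, hbw⟩ := exists_between hj
  have hlt : b / w j < 1 := (div_lt_one hwj).2 hbw
  have hsj : Tendsto (fun n => (s n j : ℝ)) atTop atTop :=
    tendsto_natCast_atTop_atTop.comp (hs.tendsto_size hθ j)
  have hδ : ∀ᶠ n in atTop, b / w j ≤ (s n j : ℝ) / (s n j + 1) := by
    filter_upwards [hsj.eventually_ge_atTop (b / w j / (1 - b / w j))] with n hn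
    rw [div_le_iff₀ (by linarith)] at hn
    rw [le_div_iff₀ (by positivity)]
    linarith
  obtain ⟨C₁, hC₁⟩ := hs.exists_exp_le_size hθ hδ
  rw [div_mul_cancel₀ b hwj.ne'] at hC₁
  obtain ⟨C₂, hC₂⟩ := hs.lightCustomers_le q hq
  have hlim : Tendsto (fun n => C₂ * Real.exp C₁ * Real.exp ((q - b) * clock θ w s n)) atTop
      (𝓝 (C₂ * Real.exp C₁ * 0)) :=
    (Real.tendsto_exp_atBot.comp
      ((hs.tendsto_clock hθ).const_mul_atTop_of_neg (sub_neg.2 hqb))).const_mul _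
  rw [mul_zero] at hlim
  refine squeeze_zero' (Eventually.of_forall fun n =>
    div_nonneg (lightCustomers_nonneg _ _ _) (Nat.cast_nonneg _)) ?_ hlim
  filter_upwards [hC₁, hsj.eventually_ge_atTop 1] with n h1 h2
  rw [max_eq_left h2, Real.le_log_iff_exp_le (by linarith)] at h1
  rw [div_le_iff₀ (by linarith)]
  have hC₂0 : 0 ≤ C₂ :=
    nonneg_of_mul_nonneg_left ((lightCustomers_nonneg _ _ _).trans (hC₂ n)) (Real.exp_pos _)
  calc lightCustomers q w (s n) ≤ C₂ * Real.exp (q * clock θ w s n) := hC₂ n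
    _ = C₂ * Real.exp C₁ * Real.exp ((q - b) * clock θ w s n) *
        Real.exp (b * clock θ w s n - C₁) := by
      rw [mul_assoc, mul_assoc, ← Real.exp_add, ← Real.exp_add]
      ring_nf
    _ ≤ _ := by gcongr

lemma tendsto_lightCustomers_div (hs : Typical θ M w s) (hθ : 0 < θ) {q : ℚ} (hq : 0 < q)
    (hqM : ((q : ℝ) : EReal) < M) :
    Tendsto (fun n : ℕ => lightCustomers q w (s n) / (n + 1)) atTop (𝓝 0) := by
  obtain ⟨j, hj⟩ := hs.exists_weight_gt q hqM
  refine squeeze_zero' (Eventually.of_forall fun n =>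
    div_nonneg (lightCustomers_nonneg _ _ _) (by positivity)) ?_
    (hs.tendsto_lightCustomers_div_size hθ hq hj)
  filter_upwards [hs.eventually_one_le hθ j] with n hn
  have h1 : (s n j : ℝ) ≤ n + 1 := by exact_mod_cast (hs.reachable n).le j
  have h2 : (0 : ℝ) < s n j := by exact_mod_cast hn
  exact div_le_div_of_nonneg_left (lightCustomers_nonneg _ _ _) h2 h1

/-- As no weight attains the essential supremum `M`, every table is light for some level below
`M`. -/
lemma exists_rat_weight_le (hs : Typical θ M w s) (k : ℕ) :
    ∃ q : ℚ, 0 < q ∧ w k ≤ q ∧ ((q : ℝ) : EReal) < M := by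
  obtain ⟨q, h1, h2⟩ := EReal.lt_iff_exists_rat_btwn.1 (hs.weight_lt k)
  have h1' : w k < q := by exact_mod_cast h1
  exact ⟨q, by exact_mod_cast (hs.weight_pos k).trans h1', h1'.le, h2⟩

lemma tendsto_size_div (hs : Typical θ M w s) (hθ : 0 < θ) (k : ℕ) :
    Tendsto (fun n : ℕ => (s n k : ℝ) / n) atTop (𝓝 0) := by
  obtain ⟨q, hq, hkq, hqM⟩ := hs.exists_rat_weight_le k
  have h2 := (hs.tendsto_lightCustomers_div hθ hq hqM).const_mul 2
  rw [mul_zero] at h2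
  refine squeeze_zero' (Eventually.of_forall fun n => by positivity) ?_ h2
  filter_upwards [eventually_ge_atTop 1] with n hn
  have hn' : (1 : ℝ) ≤ n := by exact_mod_cast hn
  have h3 := le_lightCustomers (hs.reachable n) hkq
  have h4 := lightCustomers_nonneg (q : ℝ) w (s n)
  rw [← mul_div_assoc, div_le_div_iff₀ (by linarith) (by linarith)]
  nlinarith [Nat.cast_nonneg (α := ℝ) (s n k)]

lemma eventually_exists_lt (hs : Typical θ M w s) (hθ : 0 < θ) (k : ℕ) :
    ∀ᶠ n in atTop, ∃ j, s n k < s n j := by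
  obtain ⟨q, hq, hkq, hqM⟩ := hs.exists_rat_weight_le k
  obtain ⟨j, hj⟩ := hs.exists_weight_gt q hqM
  filter_upwards [(hs.tendsto_lightCustomers_div_size hθ hq hj).eventually_lt_const one_pos,
    hs.eventually_one_le hθ j] with n h1 h2
  refine ⟨j, ?_⟩
  have h3 : (0 : ℝ) < s n j := by exact_mod_cast h2
  rw [div_lt_one h3] at h1
  exact_mod_cast (le_lightCustomers (hs.reachable n) hkq).trans_lt h1

/-- At most one table is created at a time. -/
lemma le_creationTime (hs : Typical θ M w s) {n i : ℕ} (hi : s n i ≠ 0) :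
    i ≤ creationTime s i := by
  have hmem : s (creationTime s i) i ≠ 0 := Nat.sInf_mem (s := {m | s m i ≠ 0}) ⟨n, hi⟩
  have h1 := ((hs.reachable _).occupied i).1 hmem
  have h2 := (hs.reachable (creationTime s i)).numTables_le
  omega

lemma tendsto_creationTime (hs : Typical θ M w s) (hθ : 0 < θ) {b : ℕ → ℕ}
    (hb : ∀ n, IsLargestTable (s n) (b n)) :
    Tendsto (fun n => creationTime s (b n)) atTop atTop := by
  refine tendsto_atTop.2 fun N => ?_
  have h : ∀ᶠ n in atTop, ∀ k ∈ Finset.range N, ∃ j, s n k < s n j :=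
    (Finset.eventually_all _).2 fun k _ => hs.eventually_exists_lt hθ k
  filter_upwards [h] with n hn
  have h0 : s n (b n) ≠ 0 := by
    have h1 := (hs.reachable n).pos (hs.reachable n).numTables_pos
    have h2 := hb n 0
    omega
  refine le_trans ?_ (hs.le_creationTime h0)
  by_contra hlt
  obtain ⟨j, hj⟩ := hn (b n) (Finset.mem_range.2 (not_le.1 hlt))
  exact absurd (hb n j) (not_le.2 hj)

/-- If the largest proportion tended to one, then from some time on a table would hold more than
three quarters of the customers. This table could never change, as the next one would have to do so
as well, but no fixed table keeps a positive proportion. -/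
lemma not_tendsto_iSup (hs : Typical θ M w s) (hθ : 0 < θ) :
    ¬ Tendsto (fun n : ℕ => ⨆ i, (s n i : ℝ) / n) atTop (𝓝 1) := by
  intro h
  have hev : ∀ᶠ n : ℕ in atTop, ∃ i, 3 / 4 * (n : ℝ) < s n i := by
    filter_upwards [h.eventually_const_lt (by norm_num : (3 / 4 : ℝ) < 1),
      eventually_gt_atTop 0] with n hn hn0
    obtain ⟨i, hi⟩ := exists_lt_of_lt_ciSup hn
    exact ⟨i, (lt_div_iff₀ (by exact_mod_cast hn0)).1 hi⟩
  obtain ⟨N, hN⟩ := eventually_atTop.1 (hev.and (eventually_ge_atTop 3))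
  obtain ⟨k, hk⟩ := (hN N le_rfl).1
  have hconst : ∀ n ≥ N, 3 / 4 * (n : ℝ) < s n k := by
    intro n hn
    induction n, hn using Nat.le_induction with
    | base => exact hk
    | succ n hn ih =>
      obtain ⟨i, hi⟩ := (hN (n + 1) (by omega)).1
      by_cases hik : i = k
      · rwa [hik] at hi
      · exfalso
        have h1 := (hs.reachable (n + 1)).le_sum {i, k}
        rw [Finset.sum_pair hik] at h1
        have h1' : (s (n + 1) i : ℝ) + s (n + 1) k ≤ n + 1 + 1 := by exact_mod_cast h1
        have h2 : (s n k : ℝ) ≤ s (n + 1) k := by exact_mod_cast hs.mono k (Nat.le_succ n)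
        have h3 : (3 : ℝ) ≤ n := by exact_mod_cast (hN n hn).2
        push_cast at hi
        linarith
  have hsmall := (hs.tendsto_size_div hθ k).eventually_lt_const (by norm_num : (0 : ℝ) < 3 / 4)
  obtain ⟨n, h1, h2, h3⟩ := (hsmall.and ((eventually_ge_atTop N).and
    (eventually_gt_atTop 0))).exists
  rw [div_lt_iff₀ (by exact_mod_cast h3)] at h1
  exact lt_asymm h1 (hconst n h2)

/-! ### The number of tables -/

/-- Almost all customers sit at tables of weight above `q`. -/
lemma eventually_lt_total_div (hs : Typical θ M w s) (hθ : 0 < θ) {q : ℚ} (hq : 0 < q)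
    (hqM : ((q : ℝ) : EReal) < M) {a : ℝ} (ha : a < q) :
    ∀ᶠ n : ℕ in atTop, a < total θ w (s n) / (n + 1) := by
  have hq' : (0 : ℝ) < q := by exact_mod_cast hq
  have h := ((hs.tendsto_lightCustomers_div hθ hq hqM).const_sub 1).const_mul (q : ℝ)
  rw [sub_zero, mul_one] at h
  filter_upwards [h.eventually_const_lt ha] with n hn
  refine hn.trans_le ?_
  have hn1 : (0 : ℝ) < n + 1 := by positivity
  rw [le_div_iff₀ hn1]
  refine le_trans (le_of_eq ?_)
    (mul_sub_lightCustomers_le_total hθ hs.weight_pos (hs.reachable n) q)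
  field_simp

/-- If the total propensity is asymptotic to the number of customers divided by `c`, then there are
`θ * c * log n` tables in the limit. -/
lemma tendsto_numTables_div_log (hs : Typical θ M w s) (hθ : 0 < θ) {c : ℝ}
    (hc : Tendsto (fun n : ℕ => (total θ w (s n) / (n + 1))⁻¹) atTop (𝓝 c)) :
    Tendsto (fun n : ℕ => (numTables (s n) : ℝ) / Real.log n) atTop (𝓝 (θ * c)) := by
  set g : ℕ → ℝ := fun k => ((k : ℝ) + 1)⁻¹ with hg
  have hgsum : Tendsto (fun n => ∑ k ∈ Finset.range n, g k) atTop atTop := by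
    simpa [hg, one_div] using Real.tendsto_sum_range_one_div_nat_succ_atTop
  have hlo : (fun k => (total θ w (s k))⁻¹ - c * g k) =o[atTop] g := by
    refine (Asymptotics.isLittleO_iff_tendsto' (Eventually.of_forall fun k hk => ?_)).2 ?_
    · exact absurd hk (by simp only [hg]; positivity)
    · have := hc.sub_const c
      rw [sub_self] at this
      refine this.congr fun k => ?_
      have hk : (k : ℝ) + 1 ≠ 0 := by positivity
      simp only [hg]
      rw [inv_div]
      field_simp
  have hsum := (hlo.sum_range (fun k => by simp only [hg, Pi.zero_apply]; positivity)
    hgsum).tendsto_div_nhds_zero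
  have hclock : Tendsto (fun n => clock θ w s n / ∑ k ∈ Finset.range n, g k) atTop (𝓝 c) := by
    have h1 := hsum.add_const c
    rw [zero_add] at h1
    refine h1.congr' ?_
    filter_upwards [hgsum.eventually_gt_atTop 0] with n hn
    rw [Finset.sum_sub_distrib, ← Finset.mul_sum, sub_div, mul_div_cancel_right₀ _ hn.ne',
      sub_add_cancel, clock]
  have hprod := ((hs.tendsto_numTables_div_clock hθ).mul hclock).mul tendsto_sum_inv_add_one_div_log
  rw [mul_one] at hprod
  refine hprod.congr' ?_
  filter_upwards [hgsum.eventually_gt_atTop 0,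
    (hs.tendsto_clock hθ).eventually_gt_atTop 0] with n h1 h2
  rw [div_mul_div_cancel₀ h2.ne', div_mul_div_cancel₀ h1.ne']

theorem tendsto_numTables_div_log_ereal (hs : Typical θ M w s) (hθ : 0 < θ) :
    Tendsto (fun n : ℕ => (((numTables (s n) : ℝ) / Real.log n : ℝ) : EReal)) atTop
      (𝓝 ((θ : EReal) / M)) := by
  have hM0 : (0 : EReal) < M := lt_trans (by exact_mod_cast hs.weight_pos 0) (hs.weight_lt 0)
  have hlower : ∀ a : ℝ, (a : EReal) < M → ∀ᶠ n : ℕ in atTop, a < total θ w (s n) / (n + 1) := by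
    intro a ha
    obtain ⟨q, h1, h2⟩ := EReal.lt_iff_exists_rat_btwn.1 (max_lt ha hM0)
    have h3 : a < q := by exact_mod_cast (le_max_left _ _).trans_lt h1
    have h4 : (0 : ℝ) < q := by exact_mod_cast (le_max_right _ _).trans_lt h1
    exact hs.eventually_lt_total_div hθ (by exact_mod_cast h4) h2 h3
  induction M with
  | bot => exact absurd hM0 (by simp)
  | top =>
    have h1 : Tendsto (fun n : ℕ => total θ w (s n) / (n + 1)) atTop atTop :=
      tendsto_atTop.2 fun a => (hlower a (EReal.coe_lt_top a)).mono fun _ h => h.le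
    have h2 := hs.tendsto_numTables_div_log hθ h1.inv_tendsto_atTop
    rw [mul_zero] at h2
    rw [EReal.div_top]
    exact_mod_cast (continuous_coe_real_ereal.tendsto 0).comp h2
  | coe m =>
    have hm : 0 < m := by exact_mod_cast hM0
    have h1 : Tendsto (fun n : ℕ => total θ w (s n) / (n + 1)) atTop (𝓝 m) := by
      refine tendsto_order.2 ⟨fun a ha => hlower a (by exact_mod_cast ha), fun a ha => ?_⟩
      have h2 : Tendsto (fun n : ℕ => m + θ * (1 / ((n : ℝ) + 1))) atTop (𝓝 (m + θ * 0)) :=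
        (tendsto_one_div_add_atTop_nhds_zero_nat.const_mul θ).const_add m
      rw [mul_zero, add_zero] at h2
      filter_upwards [h2.eventually_lt_const ha] with n hn
      refine lt_of_le_of_lt ?_ hn
      have hn1 : (0 : ℝ) < n + 1 := by positivity
      rw [div_le_iff₀ hn1]
      refine (total_le_mul (hs.reachable n) fun i =>
        (EReal.coe_lt_coe_iff.1 (hs.weight_lt i)).le).trans (le_of_eq ?_)
      field_simp
    have h2 := hs.tendsto_numTables_div_log hθ (h1.inv₀ hm.ne')
    rw [← EReal.coe_div, div_eq_mul_inv]
    exact (continuous_coe_real_ereal.tendsto _).comp h2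

end Typical

end WeightedCRP

theorem mainTheorem6 {Ω : Type*} [MeasurableSpace Ω] (P : Measure Ω) [IsProbabilityMeasure P]
    (θ : ℝ) (hθ : 0 < θ)
    (μ : Measure ℝ) [IsProbabilityMeasure μ]
    (hμ_pos : μ (Set.Iic 0) = 0)
    (hμ_atom : μ {x : ℝ | (x : EReal) = WeightedCRP.weightEssSup μ} = 0)
    (W : ℕ → Ω → ℝ) (S : ℕ → Ω → ℕ → ℕ) (hS : WeightedCRP.IsWeightedCRP P θ μ W S) :
    (∀ᵐ ω ∂P, Tendsto
      (fun n : ℕ => (((WeightedCRP.numTables (S n ω) : ℝ) / Real.log n : ℝ) : EReal)) atTop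
      (𝓝 ((θ : EReal) / WeightedCRP.weightEssSup μ))) ∧
    (∀ k, ∀ᵐ ω ∂P, Tendsto (fun n => S n ω k) atTop atTop ∧
      Tendsto (fun n : ℕ => (S n ω k : ℝ) / n) atTop (𝓝 0)) ∧
    (∀ᵐ ω ∂P, ∀ b : ℕ → ℕ, (∀ n, WeightedCRP.IsLargestTable (S n ω) (b n)) →
      Tendsto (fun n => WeightedCRP.creationTime (fun m => S m ω) (b n)) atTop atTop) ∧
    (∀ᵐ ω ∂P, ¬ Tendsto (fun n : ℕ => ⨆ i, (S n ω i : ℝ) / n) atTop (𝓝 1)) := by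
  have h := hS.ae_typical hθ hμ_pos hμ_atom
  refine ⟨?_, fun k => ?_, ?_, ?_⟩
  · filter_upwards [h] with ω hω using hω.tendsto_numTables_div_log_ereal hθ
  · filter_upwards [h] with ω hω using ⟨hω.tendsto_size hθ k, hω.tendsto_size_div hθ k⟩
  · filter_upwards [h] with ω hω b hb using hω.tendsto_creationTime hθ hb
  · filter_upwards [h] with ω hω using hω.not_tendsto_iSup hθ
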